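/- Let $X$ be a finite alphabet with $d=|X|\ge 2$ letters and let $T_X$ be the $d$-regular rooted tree whose vertices are the finite words over $X$, where a word is joined to each word obtained from it by adjoining one letter on the right, and whose root is the empty word. For $n\ge 0$ the $n$-th level $X^n$ is the set of words of length $n$. Let $H\le \operatorname{Aut} T_X$ be a finitely generated group of automorphisms of the rooted tree, and let $\operatorname{St}_H(n)$ be the subgroup of elements of $H$ fixing every vertex of level $n$. Suppose that 1. $H$ is just-infinite, i.e. $H$ is infinite and $H/N$ is finite for every nontrivial normal subgroup $N$ of $H$; 2. $H$ is regular branch, i.e. $H$ is transitive on every level of $T_X$ and has a subgroup $K$ of finite index such that for every tuple $(k_x)_{x\in X}$ of elements of $K$ the automorphism $xw\mapsto x\,k_x(w)$ belongs to $K$, and the subgroup $K^{X}$ of $K$ formed by all these automorphisms has finite index in $K$; 3. $H$ has the congruence subgroup property, i.e. every subgroup of finite index of $H$ contains $\operatorname{St}_H(n)$ for some $n\ge 1$. For $g\in H\setminus\{1\}$ let $D_H(g)=\min\{[H:N] : N\lhd H,\ [H:N]<\infty,\ g\notin N\}$. For a finite generating set $S$ of $H$ with word length $\|\cdot\|_S$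 and for real $n>0$ let $F_H^S(n)=\max\{D_H(g) : g\in H\setminus\{1\},\ \|g\|_S\le n\}$ be the residual finiteness growth of $H$ (the maximum over the empty set being $0$). Then $F_H(n)\succeq 2^{n^{1/\log_d\delta}}$ for some $\delta=\delta(H)>1$. Explicitly: there is a real number $\delta>1$, depending only on $H$ (with its action on $T_X$), such that for every finite generating set $S$ of $H$ there is a constant $C>0$ with $$2^{\,n^{1/\log_d \delta}}\;\le\; F_H^S(Cn)\qquad\text{for all real } n\ge 1 .$$ -/

import Mathlib

namespace RootedTree

/-! ### The regular rooted tree and its automorphisms -/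

/-- The regular rooted tree `T_X`: its vertices are the finite words over `X`, and two words are
joined by an edge when one of them is obtained from the other by adjoining a letter on the right.
The root is the empty word. -/
def treeGraph (X : Type*) : SimpleGraph (List X) :=
  SimpleGraph.fromRel fun u v => ∃ x : X, v = u ++ [x]

/-- The group `Aut T_X` of automorphisms of the rooted tree, acting on the words over `X`. -/
def TreeAut (X : Type*) : Subgroup (Equiv.Perm (List X)) where
  carrier := {g | g [] = [] ∧ ∀ u v, (treeGraph X).Adj (g u) (g v) ↔ (treeGraph X).Adj u v}
  one_mem' := ⟨rfl, fun _ _ => Iff.rfl⟩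
  mul_mem' := by
    rintro a b ⟨ha, ha'⟩ ⟨hb, hb'⟩
    refine ⟨?_, fun u v => ?_⟩
    · rw [Equiv.Perm.mul_apply, hb, ha]
    · rw [Equiv.Perm.mul_apply, Equiv.Perm.mul_apply, ha', hb']
  inv_mem' := by
    rintro a ⟨ha, ha'⟩
    refine ⟨?_, fun u v => ?_⟩
    · rw [Equiv.Perm.inv_eq_iff_eq, ha]
    · simpa using (ha' (a⁻¹ u) (a⁻¹ v)).symm

variable {X : Type*}

/-- The principal congruence subgroup `St_H(n)`: the elements of `H` that fix every vertex of the
`n`-th level. -/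
def levelStabilizer (H : Subgroup (TreeAut X)) (n : ℕ) : Subgroup H :=
  ⨅ v : List X, ⨅ _ : v.length = n, MulAction.stabilizer H v

/-- `H` acts transitively on each level of the tree. -/
def IsLevelTransitive (H : Subgroup (TreeAut X)) : Prop :=
  ∀ u v : List X, u.length = v.length → ∃ g ∈ H, g • u = v

/-- `h` is the restriction `g|_v`, that is, `g(vw) = g(v) h(w)` for all words `w`. -/
def IsRestriction (g : TreeAut X) (v : List X) (h : TreeAut X) : Prop :=
  ∀ w : List X, g • (v ++ w) = (g • v) ++ (h • w)

/-- `g = (k_x)_{x ∈ X}` on the first level: `g` fixes the first level pointwise, and its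
restriction on the vertex `x` is `k x`. -/
def IsTuple (g : TreeAut X) (k : X → TreeAut X) : Prop :=
  ∀ x : X, g • [x] = [x] ∧ IsRestriction g [x] (k x)

/-- `K` geometrically contains `K^X`: every tuple of elements of `K` is realised by an element
of `K`. -/
def GeometricallyContains (K : Subgroup (TreeAut X)) : Prop :=
  ∀ k : X → TreeAut X, (∀ x, k x ∈ K) → ∃ g ∈ K, IsTuple g k

/-- The copy of `K^X` in `Aut T_X`: the automorphisms `(k_x)_{x ∈ X}` with all `k_x` in `K`. -/
def geometricPower (K : Subgroup (TreeAut X)) : Subgroup (TreeAut X) where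
  carrier := {g | ∃ k : X → TreeAut X, (∀ x, k x ∈ K) ∧ IsTuple g k}
  one_mem' := ⟨fun _ => 1, fun _ => K.one_mem, fun x => by simp [IsRestriction]⟩
  mul_mem' := by
    rintro a b ⟨k, hk, ha⟩ ⟨l, hl, hb⟩
    refine ⟨fun x => k x * l x, fun x => K.mul_mem (hk x) (hl x), fun x => ⟨?_, fun w => ?_⟩⟩
    · rw [mul_smul, (hb x).1, (ha x).1]
    · rw [mul_smul, mul_smul, mul_smul, (hb x).2, (hb x).1, (ha x).2]
  inv_mem' := by
    rintro a ⟨k, hk, ha⟩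
    have h1 : ∀ x : X, a⁻¹ • [x] = [x] := fun x => by rw [inv_smul_eq_iff, (ha x).1]
    refine ⟨fun x => (k x)⁻¹, fun x => K.inv_mem (hk x), fun x => ⟨h1 x, fun w => ?_⟩⟩
    rw [inv_smul_eq_iff, h1, (ha x).2, (ha x).1, smul_inv_smul]

/-- A regular branch group: a level transitive group `G` with a finite index subgroup `K` that
geometrically contains `K^X` as a subgroup of finite index. -/
def IsRegularBranch (G : Subgroup (TreeAut X)) : Prop :=
  IsLevelTransitive G ∧
    ∃ K : Subgroup (TreeAut X), K ≤ G ∧ (K.subgroupOf G).FiniteIndex ∧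
      GeometricallyContains K ∧ ((geometricPower K).subgroupOf K).FiniteIndex

/-- The congruence subgroup property: every subgroup of finite index contains a principal
congruence subgroup. -/
def HasCongruenceSubgroupProperty (G : Subgroup (TreeAut X)) : Prop :=
  ∀ L : Subgroup G, L.FiniteIndex → ∃ n : ℕ, 1 ≤ n ∧ levelStabilizer G n ≤ L

end RootedTree

namespace ResidualGrowth

variable {G : Type*} [Group G]

/-- A just-infinite group: an infinite group all of whose proper quotients are finite. -/
def IsJustInfinite (G : Type*) [Group G] : Prop :=
  Infinite G ∧ ∀ N : Subgroup G, N.Normal → N ≠ ⊥ → Finite (G ⧸ N)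

/-- The word length of `g` with respect to a generating set `S`: the least length of a word in
`S ∪ S⁻¹` representing `g`. -/
noncomputable def wordLength (S : Set G) (g : G) : ℕ :=
  sInf {m | ∃ l : List G, (∀ s ∈ l, s ∈ S ∨ s⁻¹ ∈ S) ∧ l.prod = g ∧ l.length = m}

/-- The depth `D_G(g)` of an element `g ≠ 1` of a residually finite group: the least (finite) index
of a normal subgroup that does not contain `g`. -/
noncomputable def depth (g : G) : ℕ :=
  sInf {m | ∃ N : Subgroup G, N.Normal ∧ N.FiniteIndex ∧ g ∉ N ∧ N.index = m}

/-- The residual finiteness growth `F_G^S` with respect to a finite generating set `S`: the maximum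
of `D_G(g)` over the elements `g ≠ 1` of word length at most `n`. -/
noncomputable def residualGrowth (S : Finset G) (n : ℝ) : ℕ :=
  sSup {m | ∃ g : G, g ≠ 1 ∧ (wordLength (S : Set G) g : ℝ) ≤ n ∧ depth g = m}

/-- The comparison `f ⪯ g` of growth functions: `f(n) ≤ g(Cn)` for some constant `C > 0`. Growth
functions are compared on `n ≥ 1`, because balls of radius less than `1` contain no nontrivial
element. -/
def GrowthLE (f g : ℝ → ℝ) : Prop :=
  ∃ C : ℝ, 0 < C ∧ ∀ n : ℝ, 1 ≤ n → f n ≤ g (C * n)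

end ResidualGrowth

namespace RootedTree

variable {X : Type*}

/-! Short elements lying deep in the tree force large finite quotients. Take `a`, `b` in the
branching subgroup `K` with `[a, b] ≠ 1`, and let `a` move a word `p`. Place `a` and `b` at a vertex
`v` of length `j + |p|`, giving `A` and `B`. A normal subgroup missing `[A, B]` lies in the
stabilizer of level `|v|` (`le_levelStabilizer_of_commutator_notMem`), and so has index at least `2
^ d ^ j` (`two_pow_le_index_of_le_levelStabilizer`). Placement at a letter is a homomorphism on the
finitely generated group `K`, so it stretches words by at most some factor `L`; hence `[A, B]` has
length `O(L ^ j)` (`exists_list_isPlacedAt`). Comparing `L ^ j ≈ n` with `d ^ j` gives the exponent,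
with `δ = L`. -/

/-! ### Tree automorphisms preserve length and prefixes -/

theorem treeGraph_adj_iff {u v : List X} :
    (treeGraph X).Adj u v ↔ (∃ x, v = u ++ [x]) ∨ ∃ x, u = v ++ [x] := by
  rw [treeGraph, SimpleGraph.fromRel_adj]
  refine ⟨fun h => h.2, fun h => ⟨?_, h⟩⟩
  rintro rfl
  simp at h

theorem smul_nil (g : TreeAut X) : g • ([] : List X) = [] := g.2.1

theorem treeGraph_adj_smul (g : TreeAut X) {u v : List X} (h : (treeGraph X).Adj u v) :
    (treeGraph X).Adj (g • u) (g • v) := (g.2.2 u v).2 h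

theorem length_smul_of_length_le (n : ℕ) :
    ∀ (g : TreeAut X) (w : List X), w.length ≤ n → (g • w).length = w.length := by
  induction n with
  | zero =>
    intro g w hw
    rw [List.length_eq_zero_iff.1 (Nat.le_zero.1 hw), smul_nil]
  | succ n ih =>
    intro g w hw
    rcases List.eq_nil_or_concat' w with rfl | ⟨u, x, rfl⟩
    · rw [smul_nil]
    have hu : u.length ≤ n := by simpa using hw
    have hgu := ih g u hu
    rcases treeGraph_adj_iff.1
      (treeGraph_adj_smul g (treeGraph_adj_iff.2 (Or.inl ⟨x, rfl⟩))) with ⟨y, hy⟩ | ⟨y, hy⟩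
    · rw [hy]; simp [hgu]
    -- The child cannot go to the parent of `g • u`: that word is short enough for the induction
    -- hypothesis on `g⁻¹`.
    · have h1 : (g • u).length = (g • (u ++ [x])).length + 1 := by rw [hy]; simp
      have h2 := ih g⁻¹ (g • (u ++ [x])) (by omega)
      rw [inv_smul_smul] at h2
      simp at h2
      omega

theorem length_smul (g : TreeAut X) (w : List X) : (g • w).length = w.length :=
  length_smul_of_length_le _ g w le_rfl

theorem smul_isPrefix_smul (g : TreeAut X) {u w : List X} (h : u <+: w) : g • u <+: g • w := by
  obtain ⟨t, rfl⟩ := h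
  induction t using List.reverseRecOn with
  | nil => simp
  | append_singleton t x ih =>
    refine ih.trans ?_
    rw [← List.append_assoc]
    rcases treeGraph_adj_iff.1
      (treeGraph_adj_smul g (treeGraph_adj_iff.2 (Or.inl ⟨x, rfl⟩))) with ⟨y, hy⟩ | ⟨y, hy⟩
    · exact ⟨[y], hy.symm⟩
    · have := congrArg List.length hy
      simp [length_smul] at this
      omega

theorem eq_of_isPrefix_of_length_eq {u v w : List X} (hu : u <+: w) (hv : v <+: w)
    (h : u.length = v.length) : u = v :=
  (List.prefix_of_prefix_length_le hu hv h.le).eq_of_length h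

/-! ### Elements supported on one subtree -/

/-- `g` is supported on the subtree rooted at `v`. -/
def IsSupportedAt (v : List X) (g : TreeAut X) : Prop :=
  ∀ w : List X, ¬ v <+: w → g • w = w

/-- `g` acts as `a` on the subtree rooted at `v`, and trivially elsewhere. -/
def IsPlacedAt (v : List X) (a g : TreeAut X) : Prop :=
  (∀ w : List X, g • (v ++ w) = v ++ a • w) ∧ IsSupportedAt v g

theorem IsSupportedAt.inv {v : List X} {g : TreeAut X} (h : IsSupportedAt v g) :
    IsSupportedAt v g⁻¹ := fun w hw => by rw [inv_smul_eq_iff, h w hw]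

theorem IsSupportedAt.conj {v : List X} {g : TreeAut X} (hg : IsSupportedAt v g)
    (h : TreeAut X) : IsSupportedAt (h • v) (h * g * h⁻¹) := by
  intro w hw
  have h1 : ¬ v <+: h⁻¹ • w := fun hv => hw (by simpa using smul_isPrefix_smul h hv)
  rw [mul_smul, mul_smul, hg _ h1, smul_inv_smul]

theorem IsSupportedAt.commute {u v : List X} {a b : TreeAut X} (ha : IsSupportedAt u a)
    (hb : IsSupportedAt v b) (hne : u ≠ v) (hl : u.length = v.length) : Commute a b := by
  have h : Equiv.Perm.Disjoint (a : Equiv.Perm (List X)) b := by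
    intro w
    by_cases hu : u <+: w
    · exact Or.inr (hb w fun hv => hne (eq_of_isPrefix_of_length_eq hu hv hl))
    · exact Or.inl (ha w hu)
  exact Subtype.ext h.commute

theorem IsPlacedAt.one (v : List X) : IsPlacedAt v (1 : TreeAut X) 1 :=
  ⟨fun _ => by simp, fun _ _ => one_smul _ _⟩

theorem IsPlacedAt.mul {v : List X} {a b g h : TreeAut X} (hg : IsPlacedAt v a g)
    (hh : IsPlacedAt v b h) : IsPlacedAt v (a * b) (g * h) :=
  ⟨fun w => by rw [mul_smul, hh.1, hg.1, mul_smul],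
    fun w hw => by rw [mul_smul, hh.2 w hw, hg.2 w hw]⟩

theorem IsPlacedAt.inv {v : List X} {a g : TreeAut X} (hg : IsPlacedAt v a g) :
    IsPlacedAt v a⁻¹ g⁻¹ :=
  ⟨fun w => by rw [inv_smul_eq_iff, hg.1, smul_inv_smul], hg.2.inv⟩

theorem IsPlacedAt.unique {v : List X} {a g h : TreeAut X} (hg : IsPlacedAt v a g)
    (hh : IsPlacedAt v a h) : g = h := by
  refine Subtype.ext (Equiv.ext fun w => ?_)
  by_cases hw : v <+: w
  · obtain ⟨t, rfl⟩ := hw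
    exact (hg.1 t).trans (hh.1 t).symm
  · exact (hg.2 w hw).trans (hh.2 w hw).symm

theorem IsPlacedAt.nil (a : TreeAut X) : IsPlacedAt [] a a :=
  ⟨fun _ => rfl, fun w hw => absurd w.nil_prefix hw⟩

theorem IsPlacedAt.comp {u v : List X} {a b c : TreeAut X} (h1 : IsPlacedAt u b c)
    (h2 : IsPlacedAt v a b) : IsPlacedAt (u ++ v) a c := by
  refine ⟨fun w => by rw [List.append_assoc, h1.1, h2.1, List.append_assoc], fun w hw => ?_⟩
  by_cases hu : u <+: w
  · obtain ⟨t, rfl⟩ := hu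
    rw [h1.1, h2.2 t fun h => hw ((List.prefix_append_right_inj u).2 h)]
  · exact h1.2 w hu

theorem IsPlacedAt.ne_one {v : List X} {a g : TreeAut X} (h : IsPlacedAt v a g) (ha : a ≠ 1) :
    g ≠ 1 := by
  rintro rfl
  refine ha (Subtype.ext (Equiv.ext fun w => ?_))
  have := h.1 w
  rw [one_smul] at this
  exact (List.append_cancel_left this).symm

open Classical in
theorem IsTuple.isPlacedAt {g a : TreeAut X} {x : X}
    (h : IsTuple g (Function.update (fun _ => 1) x a)) : IsPlacedAt [x] a g := by
  refine ⟨fun w => ?_, fun w hw => ?_⟩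
  · rw [(h x).2, (h x).1, Function.update_self]
  · cases w with
    | nil => exact smul_nil g
    | cons y t =>
      have hy : y ≠ x := by rintro rfl; exact hw ⟨t, rfl⟩
      have := (h y).2 t
      rwa [(h y).1, Function.update_of_ne hy, one_smul] at this

/-! ### Placing elements of the branching subgroup -/

theorem GeometricallyContains.exists_isPlacedAt_singleton {K : Subgroup (TreeAut X)}
    (hK : GeometricallyContains K) {a : TreeAut X} (ha : a ∈ K) (x : X) :
    ∃ g ∈ K, IsPlacedAt [x] a g := by
  classical
  obtain ⟨g, hg, h⟩ := hK (Function.update (fun _ => 1) x a) fun y => by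
    by_cases hy : y = x
    · subst hy; simpa using ha
    · simp [hy]
  exact ⟨g, hg, h.isPlacedAt⟩

theorem GeometricallyContains.exists_isPlacedAt {K : Subgroup (TreeAut X)}
    (hK : GeometricallyContains K) {a : TreeAut X} (ha : a ∈ K) (v : List X) :
    ∃ g ∈ K, IsPlacedAt v a g := by
  induction v with
  | nil => exact ⟨a, ha, IsPlacedAt.nil a⟩
  | cons x v ih =>
    obtain ⟨b, hb, hb'⟩ := ih
    obtain ⟨c, hc, hc'⟩ := hK.exists_isPlacedAt_singleton hb x
    exact ⟨c, hc, hc'.comp hb'⟩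

theorem GeometricallyContains.exists_level_tuple {K : Subgroup (TreeAut X)}
    (hK : GeometricallyContains K) (j : ℕ) (k : List X → TreeAut X) (hk : ∀ v, k v ∈ K) :
    ∃ g ∈ K, ∀ v w : List X, v.length = j → g • (v ++ w) = v ++ k v • w := by
  induction j generalizing k with
  | zero =>
    refine ⟨k [], hk [], fun v w hv => ?_⟩
    rw [List.length_eq_zero_iff.1 hv]; rfl
  | succ j ih =>
    choose f hf hf' using fun x : X => ih (fun v => k (x :: v)) fun v => hk _
    obtain ⟨g, hg, h⟩ := hK f hf
    refine ⟨g, hg, fun v w hv => ?_⟩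
    cases v with
    | nil => simp at hv
    | cons x v =>
      have h1 := (h x).2 (v ++ w)
      rw [(h x).1, hf' x v w (by simpa using hv)] at h1
      exact h1

theorem exists_smul_ne {a : TreeAut X} (ha : a ≠ 1) : ∃ w : List X, a • w ≠ w := by
  by_contra! h
  exact ha (Subtype.ext (Equiv.ext h))

/-- Let `b` be a copy of `a` placed at a word `p` moved by `a`. Then `a * b * a⁻¹` lives below `a •
p ≠ p`, so it fixes `p ++ p`, which `b` moves. -/
theorem GeometricallyContains.exists_not_commute {K : Subgroup (TreeAut X)}
    (hK : GeometricallyContains K) {a : TreeAut X} (ha : a ∈ K) (ha' : a ≠ 1) :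
    ∃ b ∈ K, a * b * a⁻¹ * b⁻¹ ≠ 1 := by
  obtain ⟨p, hp⟩ := exists_smul_ne ha'
  obtain ⟨b, hb, hb'⟩ := hK.exists_isPlacedAt ha p
  refine ⟨b, hb, fun h => ?_⟩
  have h1 : a * b * a⁻¹ = b := by simpa using mul_eq_one_iff_eq_inv.1 h
  have h2 := hb'.2.conj a
  rw [h1] at h2
  have h3 := h2 (p ++ p) fun h => hp (eq_of_isPrefix_of_length_eq h ⟨p, rfl⟩ (length_smul a p))
  rw [hb'.1] at h3
  exact hp (List.append_cancel_left h3)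

/-! ### Level stabilizers and normal subgroups -/

theorem mem_levelStabilizer {H : Subgroup (TreeAut X)} {n : ℕ} {g : H} :
    g ∈ levelStabilizer H n ↔ ∀ v : List X, v.length = n → (g : TreeAut X) • v = v := by
  simp only [levelStabilizer, Subgroup.mem_iInf, MulAction.mem_stabilizer_iff]
  rfl

instance levelStabilizer_normal (H : Subgroup (TreeAut X)) (n : ℕ) :
    (levelStabilizer H n).Normal := by
  refine ⟨fun g hg h => mem_levelStabilizer.2 fun v hv => ?_⟩
  push_cast
  rw [mul_smul, mul_smul, mem_levelStabilizer.1 hg _ (by rw [length_smul, hv]), smul_inv_smul]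

instance levelStabilizer_finiteIndex [Finite X] (H : Subgroup (TreeAut X)) (n : ℕ) :
    (levelStabilizer H n).FiniteIndex := by
  have : Finite {v : List X // v.length = n} := List.finite_length_eq X n
  have h : ∀ v : List X, (MulAction.stabilizer H v).FiniteIndex := fun v => by
    have hv : (MulAction.orbit H v).Finite := (List.finite_length_eq X v.length).subset <| by
      rintro _ ⟨g, rfl⟩
      exact length_smul (g : TreeAut X) v
    have : Finite (MulAction.orbit H v) := hv
    have := Finite.of_equiv _ (MulAction.orbitEquivQuotientStabilizer H v)
    exact Subgroup.finiteIndex_of_finite_quotient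
  rw [levelStabilizer, iInf_subtype']
  exact Subgroup.finiteIndex_iInf fun v => h v

/-- Double commutator trick: if `N` moves a vertex of this level, transitivity gives a conjugate `m
∈ N` moving `v`. Then `m A⁻¹ m⁻¹` commutes with `B`, so `[[A, m], B] = [A, B]` lies in `N`. -/
theorem le_levelStabilizer_of_commutator_notMem {H : Subgroup (TreeAut X)}
    (hH : IsLevelTransitive H) {N : Subgroup H} (hN : N.Normal) {v : List X} {A B : H}
    (hA : IsSupportedAt v (A : TreeAut X)) (hB : IsSupportedAt v (B : TreeAut X))
    (h : A * B * A⁻¹ * B⁻¹ ∉ N) : N ≤ levelStabilizer H v.length := by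
  refine fun n hn => mem_levelStabilizer.2 fun u hu => by_contra fun hne => h ?_
  obtain ⟨t, ht, rfl⟩ := hH u v hu
  have hm : (⟨t, ht⟩ * n * ⟨t, ht⟩⁻¹ : H) ∈ N := hN.conj_mem n hn _
  set m : H := ⟨t, ht⟩ * n * ⟨t, ht⟩⁻¹ with hmdef
  have hmv : (m : TreeAut X) • t • u ≠ t • u := by
    rw [hmdef]
    simpa [mul_smul] using hne
  have hc : Commute (m * A⁻¹ * m⁻¹) B :=
    Subtype.ext ((hA.inv.conj m).commute hB hmv (length_smul _ _))
  have hn1 : A * (m * A⁻¹ * m⁻¹) ∈ N := by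
    have := N.mul_mem (hN.conj_mem m hm A) (N.inv_mem hm)
    simpa only [mul_assoc] using this
  have hn2 := N.mul_mem hn1 (hN.conj_mem _ (N.inv_mem hn1) B)
  convert hn2 using 1
  have hc' : m * A⁻¹ * m⁻¹ * B * (m * A⁻¹ * m⁻¹)⁻¹ = B := by rw [hc.eq]; group
  calc A * B * A⁻¹ * B⁻¹
      = A * (m * A⁻¹ * m⁻¹ * B * (m * A⁻¹ * m⁻¹)⁻¹) * A⁻¹ * B⁻¹ := by rw [hc']
    _ = _ := by group

/-- The level-`j` tuples with entries in `{1, a}` lie in distinct cosets: two that differ at `v`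
disagree on `v ++ p`. -/
theorem two_pow_le_index_of_le_levelStabilizer [Fintype X] {H K : Subgroup (TreeAut X)}
    (hKH : K ≤ H) (hK : GeometricallyContains K) {a : TreeAut X} (ha : a ∈ K) {p : List X}
    (hp : a • p ≠ p) (j : ℕ) {N : Subgroup H} [N.FiniteIndex]
    (hN : N ≤ levelStabilizer H (j + p.length)) : 2 ^ Fintype.card X ^ j ≤ N.index := by
  classical
  choose f hf hf' using fun s : Set {v : List X // v.length = j} =>
    hK.exists_level_tuple j (fun v => if ∃ h : v.length = j, ⟨v, h⟩ ∈ s then a else 1)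
      fun v => by split_ifs; exacts [ha, K.one_mem]
  have hinj : Function.Injective fun s => (QuotientGroup.mk (⟨f s, hKH (hf s)⟩ : H) : H ⧸ N) := by
    intro s t hst
    ext ⟨v, hv⟩
    have h1 := mem_levelStabilizer.1 (hN (QuotientGroup.eq.1 hst)) (v ++ p) (by simp [hv])
    have h2 : (f s)⁻¹ • f t • (v ++ p) = v ++ p := by rw [← mul_smul]; exact h1
    rw [inv_smul_eq_iff, hf' s v p hv, hf' t v p hv] at h2
    have h3 := List.append_cancel_left h2
    by_cases hs : (⟨v, hv⟩ : {v : List X // v.length = j}) ∈ s <;>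
      by_cases ht : (⟨v, hv⟩ : {v : List X // v.length = j}) ∈ t <;> simp [hv, hs, ht] at h3 ⊢
    · exact hp h3.symm
    · exact hp h3
  let _ : Fintype {v : List X // v.length = j} := inferInstanceAs (Fintype (List.Vector X j))
  have := Nat.card_le_card_of_injective _ hinj
  rw [Nat.card_eq_fintype_card, Fintype.card_set] at this
  exact (card_vector (α := X) j ▸ this :)

end RootedTree
namespace ResidualGrowth

variable {G : Type*} [Group G]

/-! ### Word length, depth and residual growth -/

theorem exists_list_of_closure_eq_top {S : Set G} (hS : Subgroup.closure S = ⊤) (g : G) :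
    ∃ l : List G, (∀ s ∈ l, s ∈ S ∨ s⁻¹ ∈ S) ∧ l.prod = g := by
  have hg : g ∈ (Subgroup.closure S).toSubmonoid := hS ▸ Subgroup.mem_top g
  rw [Subgroup.closure_toSubmonoid] at hg
  exact Submonoid.exists_list_of_mem_closure hg

theorem wordLength_prod_le {S : Set G} {l : List G} (hl : ∀ s ∈ l, s ∈ S ∨ s⁻¹ ∈ S) :
    wordLength S l.prod ≤ l.length :=
  Nat.sInf_le ⟨l, hl, rfl, rfl⟩

theorem exists_list_length_eq_wordLength {S : Set G} (hS : Subgroup.closure S = ⊤) (g : G) :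
    ∃ l : List G, (∀ s ∈ l, s ∈ S ∨ s⁻¹ ∈ S) ∧ l.prod = g ∧ l.length = wordLength S g := by
  obtain ⟨l, hl, hg⟩ := exists_list_of_closure_eq_top hS g
  exact Nat.sInf_mem (s := {m | ∃ l : List G, (∀ s ∈ l, s ∈ S ∨ s⁻¹ ∈ S) ∧ l.prod = g ∧
    l.length = m}) ⟨l.length, l, hl, hg, rfl⟩

theorem wordLength_mul_le {S : Set G} (hS : Subgroup.closure S = ⊤) (g h : G) :
    wordLength S (g * h) ≤ wordLength S g + wordLength S h := by
  obtain ⟨l, hl, rfl, hl'⟩ := exists_list_length_eq_wordLength hS g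
  obtain ⟨m, hm, rfl, hm'⟩ := exists_list_length_eq_wordLength hS h
  rw [← hl', ← hm', ← List.prod_append, ← List.length_append]
  refine wordLength_prod_le fun s hs => ?_
  rcases List.mem_append.1 hs with h | h
  exacts [hl s h, hm s h]

theorem wordLength_prod_le_mul {S T : Set G} (hS : Subgroup.closure S = ⊤) {M : ℕ}
    (hM : ∀ t ∈ T, wordLength S t ≤ M) {l : List G} (hl : ∀ t ∈ l, t ∈ T) :
    wordLength S l.prod ≤ M * l.length := by
  induction l with
  | nil => exact wordLength_prod_le (l := []) (by simp)
  | cons t l ih =>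
    rw [List.prod_cons, List.length_cons, mul_add_one, add_comm]
    exact (wordLength_mul_le hS t l.prod).trans (add_le_add (hM t (hl t (by simp)))
      (ih fun s hs => hl s (by simp [hs])))

theorem finite_setOf_wordLength_le (S : Finset G) (hS : Subgroup.closure (S : Set G) = ⊤)
    (n : ℕ) : {g : G | wordLength (S : Set G) g ≤ n}.Finite := by
  have hfin : {s : G | s ∈ S ∨ s⁻¹ ∈ S}.Finite :=
    S.finite_toSet.union (S.finite_toSet.preimage inv_injective.injOn)
  have : Finite {s : G | s ∈ S ∨ s⁻¹ ∈ S} := hfin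
  refine ((List.finite_length_le {s : G | s ∈ S ∨ s⁻¹ ∈ S} n).image
    fun l => (l.map Subtype.val).prod).subset fun g hg => ?_
  obtain ⟨l, hl, hg', hl'⟩ := exists_list_length_eq_wordLength hS g
  refine ⟨l.attachWith _ hl, ?_, ?_⟩
  · simpa [hl'] using hg
  · change ((l.attachWith _ hl).map Subtype.val).prod = g
    rw [List.attachWith_map_subtype_val, hg']

theorem depth_le_residualGrowth {S : Finset G} (hS : Subgroup.closure (S : Set G) = ⊤) {g : G}
    (hg : g ≠ 1) {n : ℝ} (hn : (wordLength (S : Set G) g : ℝ) ≤ n) :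
    depth g ≤ residualGrowth S n := by
  -- Balls are finite, so the supremum in `ℕ` is not the default value `0`.
  refine le_csSup (Set.Finite.bddAbove ?_) ⟨g, hg, hn, rfl⟩
  refine ((finite_setOf_wordLength_le S hS ⌊n⌋₊).image depth).subset ?_
  rintro _ ⟨h, -, hh, rfl⟩
  exact ⟨h, Nat.le_floor hh, rfl⟩

/-- The existence hypothesis excludes the infimum of the empty set, which is `0`. -/
theorem le_depth {g : G} {m : ℕ} (h : ∃ N : Subgroup G, N.Normal ∧ N.FiniteIndex ∧ g ∉ N)
    (hm : ∀ N : Subgroup G, N.Normal → N.FiniteIndex → g ∉ N → m ≤ N.index) : m ≤ depth g := by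
  obtain ⟨N, hN, hN', hg⟩ := h
  refine le_csInf ⟨_, N, hN, hN', hg, rfl⟩ ?_
  rintro _ ⟨L, hL, hL', hgL, rfl⟩
  exact hm L hL hL' hgL

end ResidualGrowth

namespace RootedTree

variable {X : Type*}

theorem exists_normal_finiteIndex_notMem [Finite X] {H : Subgroup (TreeAut X)} {g : H}
    (hg : g ≠ 1) : ∃ N : Subgroup H, N.Normal ∧ N.FiniteIndex ∧ g ∉ N := by
  obtain ⟨w, hw⟩ := exists_smul_ne fun h => hg (Subtype.ext h)
  exact ⟨levelStabilizer H w.length, inferInstance, inferInstance,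
    fun h => hw (mem_levelStabilizer.1 h w rfl)⟩

/-! ### Short words for deep elements -/

theorem exists_list_isPlacedAt_of_singleton {H : Subgroup (TreeAut X)} {T : Set H} {L : ℕ}
    {f : X → H → List H} (hf : ∀ x, ∀ t ∈ T, ∀ s ∈ f x t, s ∈ T)
    (hfp : ∀ x, ∀ t ∈ T, IsPlacedAt [x] (t : TreeAut X) ((f x t).prod : H))
    (hL : ∀ x, ∀ t ∈ T, (f x t).length ≤ L) (x : X) (l : List H) (hl : ∀ t ∈ l, t ∈ T) :
    ∃ m : List H, (∀ t ∈ m, t ∈ T) ∧ m.length ≤ L * l.length ∧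
      IsPlacedAt [x] ((l.prod : H) : TreeAut X) (m.prod : H) := by
  induction l with
  | nil => exact ⟨[], by simp, by simp, by simpa using IsPlacedAt.one [x]⟩
  | cons t l ih =>
    obtain ⟨m, hm, hml, hmp⟩ := ih fun s hs => hl s (by simp [hs])
    have ht : t ∈ T := hl t (by simp)
    refine ⟨f x t ++ m, fun s hs => ?_, ?_, ?_⟩
    · rcases List.mem_append.1 hs with h | h
      exacts [hf x t ht s h, hm s h]
    · rw [List.length_append, List.length_cons, mul_add_one, add_comm]
      exact add_le_add hml (hL x t ht)
    · rw [List.prod_append, List.prod_cons]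
      exact (hfp x t ht).mul hmp

theorem GeometricallyContains.exists_list_isPlacedAt [Finite X] {H K : Subgroup (TreeAut X)}
    (hKH : K ≤ H) (hK : GeometricallyContains K) {T : Finset H}
    (hT : Submonoid.closure (T : Set H) = (K.subgroupOf H).toSubmonoid) :
    ∃ L : ℕ, 2 ≤ L ∧ ∀ (v : List X) (l : List H), (∀ t ∈ l, t ∈ T) →
      ∃ m : List H, (∀ t ∈ m, t ∈ T) ∧ m.length ≤ L ^ v.length * l.length ∧
        IsPlacedAt v ((l.prod : H) : TreeAut X) (m.prod : H) := by
  have key : ∀ (x : X) (t : H), ∃ l : List H, t ∈ T →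
      (∀ s ∈ l, s ∈ (T : Set H)) ∧ IsPlacedAt [x] (t : TreeAut X) (l.prod : H) := by
    intro x t
    by_cases ht : t ∈ T
    · have htK : (t : TreeAut X) ∈ K := by
        have : t ∈ (K.subgroupOf H).toSubmonoid := hT ▸ Submonoid.subset_closure ht
        exact this
      obtain ⟨g, hg, hgp⟩ := hK.exists_isPlacedAt_singleton htK x
      have hgT : (⟨g, hKH hg⟩ : H) ∈ Submonoid.closure (T : Set H) := by rw [hT]; exact hg
      obtain ⟨l, hl, hlg⟩ := Submonoid.exists_list_of_mem_closure hgT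
      exact ⟨l, fun _ => ⟨hl, by rw [hlg]; exact hgp⟩⟩
    · exact ⟨[], fun h => absurd h ht⟩
  choose f hf using key
  obtain ⟨L, hL⟩ := ((Set.finite_univ.prod T.finite_toSet).image
    fun q : X × H => (f q.1 q.2).length).bddAbove
  have step := exists_list_isPlacedAt_of_singleton (T := (T : Set H)) (f := f) (L := max L 2)
    (fun x t ht => (hf x t ht).1) (fun x t ht => (hf x t ht).2)
    fun x t ht => le_max_of_le_left (hL ⟨(x, t), ⟨trivial, ht⟩, rfl⟩)
  -- The maximum with `2` will make `δ > 1`.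
  refine ⟨max L 2, le_max_right _ _, fun v l hl => ?_⟩
  induction v with
  | nil => exact ⟨l, hl, by simp, IsPlacedAt.nil _⟩
  | cons x v ih =>
    obtain ⟨m, hm, hml, hmp⟩ := ih
    obtain ⟨m', hm', hml', hmp'⟩ := step x m hm
    refine ⟨m', hm', hml'.trans ?_, hmp'.comp hmp⟩
    rw [List.length_cons, pow_succ', mul_assoc]
    exact Nat.mul_le_mul_left _ hml

theorem IsRegularBranch.exists_deep_elements [Fintype X] [Nonempty X] {H : Subgroup (TreeAut X)}
    (hfg : Group.FG H) (hinf : Infinite H) (hrb : IsRegularBranch H) :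
    ∃ (T : Finset H) (L c m : ℕ), 2 ≤ L ∧ ∀ j : ℕ, ∃ l : List H, (∀ t ∈ l, t ∈ T) ∧
      l.length ≤ L ^ (j + m) * c ∧ l.prod ≠ 1 ∧
        2 ^ Fintype.card X ^ j ≤ ResidualGrowth.depth l.prod := by
  obtain ⟨htr, K, hKH, hKfi, hK, -⟩ := hrb
  have hKinf : Infinite (K.subgroupOf H) := by
    by_contra h
    rw [not_infinite_iff_finite] at h
    have := Subgroup.finite_quotient_of_finiteIndex (H := K.subgroupOf H)
    exact not_finite_iff_infinite.2 hinf
      (Finite.of_equiv _ (Subgroup.groupEquivQuotientProdSubgroup (s := K.subgroupOf H)).symm)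
  obtain ⟨⟨a, haK⟩, ha⟩ := exists_ne (1 : K.subgroupOf H)
  have ha1 : (a : TreeAut X) ≠ 1 := fun h => ha (Subtype.ext (Subtype.ext h))
  obtain ⟨b, hb, hab⟩ := hK.exists_not_commute haK ha1
  obtain ⟨p, hp⟩ := exists_smul_ne ha1
  -- Generating `K` as a monoid avoids inverses in words.
  obtain ⟨T, hT⟩ := (Subgroup.fg_iff_submonoid_fg _).1
    ((Group.fg_iff_subgroup_fg _).1 (Subgroup.fg_of_index_ne_zero (K.subgroupOf H)))
  obtain ⟨L, hL, hplace⟩ := hK.exists_list_isPlacedAt hKH hT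
  obtain ⟨l, hl, hlg⟩ : ∃ l : List H, (∀ t ∈ l, t ∈ (T : Set H)) ∧
      l.prod = a * ⟨b, hKH hb⟩ * a⁻¹ * ⟨b, hKH hb⟩⁻¹ := by
    refine Submonoid.exists_list_of_mem_closure ?_
    rw [hT]
    exact K.mul_mem (K.mul_mem (K.mul_mem haK hb) (K.inv_mem haK)) (K.inv_mem hb)
  refine ⟨T, L, l.length, p.length, hL, fun j => ?_⟩
  set v : List X := List.replicate (j + p.length) (Classical.arbitrary X) with hv
  have hvl : v.length = j + p.length := List.length_replicate
  obtain ⟨A, hA, hA'⟩ := hK.exists_isPlacedAt haK v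
  obtain ⟨B, hB, hB'⟩ := hK.exists_isPlacedAt hb v
  obtain ⟨m, hm, hml, hmp⟩ := hplace v l hl
  rw [hlg] at hmp
  have hprod : m.prod = (⟨A, hKH hA⟩ * ⟨B, hKH hB⟩ * ⟨A, hKH hA⟩⁻¹ * ⟨B, hKH hB⟩⁻¹ : H) :=
    Subtype.ext (hmp.unique (((hA'.mul hB').mul hA'.inv).mul hB'.inv))
  have hne : m.prod ≠ 1 := fun h => hmp.ne_one hab (congrArg Subtype.val h)
  refine ⟨m, hm, hvl ▸ hml, hne, ?_⟩
  refine ResidualGrowth.le_depth (exists_normal_finiteIndex_notMem hne) fun N hN hNfi hmN => ?_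
  rw [hprod] at hmN
  exact two_pow_le_index_of_le_levelStabilizer hKH hK haK hp j
    (hvl ▸ le_levelStabilizer_of_commutator_notMem htr hN hA'.2 hB'.2 hmN)

end RootedTree
-- Comparison of growth rates
theorem Real.rpow_one_div_logb_self {d δ : ℝ} (hd : 1 < d) (hδ : 1 < δ) :
    δ ^ (1 / Real.logb d δ) = d := by
  rw [one_div, Real.inv_logb]
  exact Real.rpow_logb (by linarith) hδ.ne' (by linarith)

theorem mainTheorem2 {X : Type*} [Fintype X] (hX : 2 ≤ Fintype.card X)
    (H : Subgroup (RootedTree.TreeAut X)) (hfg : Group.FG H)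
    (hji : ResidualGrowth.IsJustInfinite H) (hrb : RootedTree.IsRegularBranch H)
    (hcsp : RootedTree.HasCongruenceSubgroupProperty H) :
    ∃ δ : ℝ, 1 < δ ∧ ∀ S : Finset H, Subgroup.closure (S : Set H) = ⊤ →
      ResidualGrowth.GrowthLE
        (fun n : ℝ => (2 : ℝ) ^ (n ^ (1 / Real.logb (Fintype.card X : ℝ) δ)))
        (fun n : ℝ => (ResidualGrowth.residualGrowth S n : ℝ)) := by
  have : Nonempty X := Fintype.card_pos_iff.1 (by omega)
  obtain ⟨T, L, c, m, hL, hdeep⟩ := hrb.exists_deep_elements hfg hji.1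
  have hd : (1 : ℝ) < Fintype.card X := by exact_mod_cast hX
  have hL1 : (1 : ℝ) < L := by exact_mod_cast hL
  -- `L` is fixed before `S`; rewriting `T` in terms of `S` only costs the factor `M`.
  refine ⟨L, hL1, fun S hS => ?_⟩
  obtain ⟨M, hM⟩ := (T.finite_toSet.image (ResidualGrowth.wordLength (S : Set H))).bddAbove
  -- The `+ 1` keeps the constant positive even if `M = 0`.
  refine ⟨M * (L ^ (m + 1) * c) + 1, by positivity, fun n hn => ?_⟩
  obtain ⟨j, hj, hj'⟩ := exists_nat_pow_near hn hL1
  -- As `L ^ j ≤ n < L ^ (j + 1)`, the index `j + 1` makes the depth large enough; the extra `L` in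
  -- length goes into the constant.
  obtain ⟨l, hl, hlen, hne, hdepth⟩ := hdeep (j + 1)
  have hword : (ResidualGrowth.wordLength (S : Set H) l.prod : ℝ) ≤
      (M * (L ^ (m + 1) * c) + 1) * n := by
    have h1 : ResidualGrowth.wordLength (S : Set H) l.prod ≤ M * (L ^ (j + 1 + m) * c) :=
      (ResidualGrowth.wordLength_prod_le_mul (T := (T : Set H)) hS
        (fun t ht => hM ⟨t, ht, rfl⟩) hl).trans (Nat.mul_le_mul_left _ hlen)
    calc (ResidualGrowth.wordLength (S : Set H) l.prod : ℝ)
        ≤ M * (L ^ (j + 1 + m) * c) := by exact_mod_cast h1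
      _ = M * (L ^ (m + 1) * c) * L ^ j := by ring
      _ ≤ M * (L ^ (m + 1) * c) * n := by gcongr
      _ ≤ _ := by linarith
  have hexp : n ^ (1 / Real.logb (Fintype.card X : ℝ) L) ≤ (Fintype.card X : ℝ) ^ (j + 1) := by
    have hpos : 0 < Real.logb (Fintype.card X : ℝ) L := Real.logb_pos hd hL1
    calc n ^ (1 / Real.logb (Fintype.card X : ℝ) L)
        ≤ ((L : ℝ) ^ (j + 1)) ^ (1 / Real.logb (Fintype.card X : ℝ) L) :=
          Real.rpow_le_rpow (by linarith) hj'.le (by positivity)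
      _ = _ := by rw [← Real.rpow_pow_comm (by positivity), Real.rpow_one_div_logb_self hd hL1]
  calc (2 : ℝ) ^ (n ^ (1 / Real.logb (Fintype.card X : ℝ) L))
      ≤ (2 : ℝ) ^ ((Fintype.card X : ℝ) ^ (j + 1)) :=
        Real.rpow_le_rpow_of_exponent_le one_le_two hexp
    _ = ((2 ^ Fintype.card X ^ (j + 1) : ℕ) : ℝ) := by
        rw [← Nat.cast_pow, Real.rpow_natCast]; push_cast; rfl
    _ ≤ (ResidualGrowth.residualGrowth S _ : ℝ) :=
        Nat.cast_le.2 (hdepth.trans (ResidualGrowth.depth_le_residualGrowth hS hne hword))
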